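/- For a two-qubit state $\rho$ and a Pauli matrix $\sigma_i$ ($i\in\{x,z\}$), let $S_{ii}^{(q)}(\rho)$ denote the Tsallis-$q$ entropy $S^{(q)}(\vec p)=\frac{1}{q-1}\bigl(1-\sum_{j:\,p_j\neq 0}p_j^{\,q}\bigr)$ of the four outcome probabilities $\vec p$ of the local measurement $\sigma_i\otimes\sigma_i$ on $\rho$, where for $q=1$ this means the Shannon entropy $S^{(1)}(\vec p)=-\sum_j p_j\log p_j$. Let $q,\tilde q\in\mathbb R$. For every separable two-qubit state $\rho$ there is a state of the form $$\rho^*=(1-p)\,|ab\rangle\langle ab|+p\,|cd\rangle\langle cd|,\qquad 0\le p\le 1,$$ where $|a\rangle,|b\rangle,|c\rangle,|d\rangle$ are one-qubit unit vectors with real components in the computational basis, $|ab\rangle=|a\rangle\otimes|b\rangle$ and $|cd\rangle=|c\rangle\otimes|d\rangle$, such that $$S_{xx}^{(\tilde q)}(\rho^*)\le S_{xx}^{(\tilde q)}(\rho)\qquad\text{and}\qquad S_{zz}^{(q)}(\rho^*)\le S_{zz}^{(q)}(\rho).$$ In particular $\rho^*$ is itself separable, has real matrix entries in the computational basis, and has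 rank at most two. -/

import Mathlib

open Matrix
open scoped Kronecker ComplexOrder

/-- Operators on one qubit, in the computational basis `|0⟩, |1⟩`. -/
abbrev QubitOp : Type := Matrix (Fin 2) (Fin 2) ℂ

/-- Operators on two qubits, in the product basis `|ij⟩`. -/
abbrev TwoQubitOp : Type := Matrix (Fin 2 × Fin 2) (Fin 2 × Fin 2) ℂ

/-- A quantum state (density matrix): positive semidefinite of trace one. -/
def IsDensityMatrix {ι : Type} [Fintype ι] (ρ : Matrix ι ι ℂ) : Prop :=
  ρ.PosSemidef ∧ ρ.trace = 1

/-- A two-qubit state is separable if it is a (finite) convex combination of product states. -/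
def IsSeparableState (ρ : TwoQubitOp) : Prop :=
  ρ ∈ convexHull ℝ
    {τ : TwoQubitOp | ∃ α β : QubitOp, IsDensityMatrix α ∧ IsDensityMatrix β ∧ τ = α ⊗ₖ β}

/-- A unit vector of `ℂ²` (a pure one-qubit state vector). -/
def IsQubitKet (a : Fin 2 → ℂ) : Prop := ∑ i, ‖a i‖ ^ 2 = 1

/-- A vector whose components in the computational basis are real. -/
def IsRealKet (a : Fin 2 → ℂ) : Prop := ∀ i, (a i).im = 0

/-- The product vector `|ab⟩ = |a⟩ ⊗ |b⟩`. -/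
def productKet (a b : Fin 2 → ℂ) : Fin 2 × Fin 2 → ℂ := fun k => a k.1 * b k.2

/-- The rank-one operator `|ψ⟩⟨ψ|`. -/
def ketBra {ι : Type} (ψ : ι → ℂ) : Matrix ι ι ℂ := vecMulVec ψ (star ψ)

/-- The Pauli matrix `σ_x`. -/
def pauliX : QubitOp := !![0, 1; 1, 0]

/-- The Pauli matrix `σ_z`. -/
def pauliZ : QubitOp := !![1, 0; 0, -1]

/-- For a Pauli matrix `σ`, the spectral projector `(1 ± σ) / 2` onto its eigenvector with
eigenvalue `+1` (outcome `0`) or `-1` (outcome `1`). -/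
noncomputable def outcomeProj (σ : QubitOp) (i : Fin 2) : QubitOp :=
  (1 / 2 : ℂ) • (1 + (-1 : ℂ) ^ (i : ℕ) • σ)

/-- The four outcome probabilities `Tr (ρ (P_i ⊗ P_j))` of the local measurement `σ ⊗ σ`. -/
noncomputable def outcomeProb (σ : QubitOp) (ρ : TwoQubitOp) (k : Fin 2 × Fin 2) : ℝ :=
  (ρ * (outcomeProj σ k.1 ⊗ₖ outcomeProj σ k.2)).trace.re

/-- The Tsallis-`q` entropy `(1 - ∑ p_j ^ q) / (q - 1)` of a finite probability vector, with its
limit, the Shannon entropy `-∑ p_j log p_j`, at `q = 1`. As usual for this entropy, the sum runs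
over the outcomes of nonzero probability; this matters only for `q ≤ 0`. -/
noncomputable def tsallisEntropy {ι : Type} [Fintype ι] (q : ℝ) (p : ι → ℝ) : ℝ :=
  if q = 1 then -∑ j, p j * Real.log (p j)
  else 1 / (q - 1) * (1 - ∑ j, if p j = 0 then 0 else p j ^ q)

/-- `S_xx^(q)`: the Tsallis-`q` entropy of the `σ_x ⊗ σ_x` measurement on `ρ`. -/
noncomputable def entropyXX (q : ℝ) (ρ : TwoQubitOp) : ℝ :=
  tsallisEntropy q (outcomeProb pauliX ρ)

/-- `S_zz^(q)`: the Tsallis-`q` entropy of the `σ_z ⊗ σ_z` measurement on `ρ`. -/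
noncomputable def entropyZZ (q : ℝ) (ρ : TwoQubitOp) : ℝ :=
  tsallisEntropy q (outcomeProb pauliZ ρ)

/-! ### Tsallis entropies of probability vectors -/

/-! The two measurements see only the Bloch coordinates `(x, z)` of each factor of a product state.
Chords of the disc reduce mixtures of products to mixtures of pairs of points on the unit circle,
and such points are exactly what real kets produce (`outcomeProb_mem_convexHull`,
`exists_realKet_hasBloch`).

For orders `q, q' ≥ 0` both entropies lie below their tangents at the distributions of `ρ`. The two
tangent functionals send each component of the mixture to a point of the plane, with weighted mean
the origin. Some segment between two of these points meets the closed third quadrant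
(`exists_pair_mixture_nonpos`); the corresponding two-term mixture raises neither entropy.

For a negative order concavity fails, but the entropy is bounded below by the size of the support. A
missing outcome of one measurement forces Bloch vectors to poles, which flattens the other
measurement, so a single product of Pauli eigenvectors suffices. -/

/-- The Tsallis entropy of a flat distribution all of whose nonzero weights equal `c`. -/
noncomputable def flatEntropy (q c : ℝ) : ℝ :=
  if q = 1 then -Real.log c else 1 / (q - 1) * (1 - c ^ (q - 1))

lemma tsallisEntropy_eq_flatEntropy {ι : Type} [Fintype ι] (q c : ℝ) (hc : 0 < c) (p : ι → ℝ)
    (hp : ∀ j, p j = 0 ∨ p j = c) (hsum : ∑ j, p j = 1) :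
    tsallisEntropy q p = flatEntropy q c := by
  unfold tsallisEntropy flatEntropy
  split_ifs with h
  · have : ∀ j, p j * Real.log (p j) = p j * Real.log c := by
      intro j
      rcases hp j with h | h <;> simp [h]
    simp only [this, ← Finset.sum_mul, hsum, one_mul]
  · have : ∀ j, (if p j = 0 then 0 else p j ^ q) = p j * c ^ (q - 1) := by
      intro j
      rcases hp j with h | h
      · simp [h]
      · rw [h, if_neg hc.ne', Real.rpow_sub_one hc.ne']
        field_simp
    simp only [this, ← Finset.sum_mul, hsum, one_mul]

/-- The entropy is the `p`-weighted average of `flatEntropy q (p j)`, and `flatEntropy q` is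
decreasing on positive arguments. -/
lemma flatEntropy_le_tsallisEntropy_of_le {ι : Type} [Fintype ι] (q c : ℝ) (p : ι → ℝ)
    (hp0 : ∀ j, 0 ≤ p j) (hpc : ∀ j, p j ≤ c) (hsum : ∑ j, p j = 1) :
    flatEntropy q c ≤ tsallisEntropy q p := by
  have hpow : ∀ j, p j ≠ 0 → p j ^ q = p j * p j ^ (q - 1) := by
    intro j hj
    have : 0 < p j := lt_of_le_of_ne (hp0 j) hj.symm
    rw [Real.rpow_sub_one hj]
    field_simp
  unfold tsallisEntropy flatEntropy
  split_ifs with h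
  · have : ∑ j, p j * Real.log (p j) ≤ ∑ j, p j * Real.log c := by
      refine Finset.sum_le_sum fun j _ => ?_
      rcases (hp0 j).eq_or_lt with h | h
      · simp [← h]
      · exact mul_le_mul_of_nonneg_left (Real.log_le_log h (hpc j)) h.le
    rw [← Finset.sum_mul, hsum] at this
    linarith
  · have key : ∑ j, p j * c ^ (q - 1) = c ^ (q - 1) := by rw [← Finset.sum_mul, hsum, one_mul]
    rcases lt_or_gt_of_ne h with h | h
    · have : ∑ j, p j * c ^ (q - 1) ≤ ∑ j, if p j = 0 then 0 else p j ^ q := by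
        refine Finset.sum_le_sum fun j _ => ?_
        split_ifs with hj
        · simp [hj]
        · rw [hpow j hj]
          exact mul_le_mul_of_nonneg_left (Real.rpow_le_rpow_of_nonpos
            (lt_of_le_of_ne (hp0 j) (Ne.symm hj)) (hpc j) (by linarith)) (hp0 j)
      rw [key] at this
      exact mul_le_mul_of_nonpos_left (by linarith)
        (one_div_nonpos.2 (by linarith))
    · have : ∑ j, (if p j = 0 then 0 else p j ^ q) ≤ ∑ j, p j * c ^ (q - 1) := by
        refine Finset.sum_le_sum fun j _ => ?_
        split_ifs with hj
        · simp [hj]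
        · rw [hpow j hj]
          exact mul_le_mul_of_nonneg_left (Real.rpow_le_rpow (hp0 j) (hpc j) (by linarith)) (hp0 j)
      rw [key] at this
      exact mul_le_mul_of_nonneg_left (by linarith)
        (one_div_nonneg.2 (by linarith))

/-- For `q < 0` the power `x ^ q` is convex, so it lies above its tangent at `1 / m`. Summed over
the support, the tangent has a constant term with factor `1 - q > 0`, so a larger support only
helps. -/
lemma flatEntropy_le_tsallisEntropy_of_card_le {ι : Type} [Fintype ι] (q : ℝ) (hq : q < 0)
    (m : ℕ) (hm : 0 < m) (p : ι → ℝ) (hp0 : ∀ j, 0 ≤ p j) (hsum : ∑ j, p j = 1)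
    (s : Finset ι) (hs : ∀ j ∈ s, p j ≠ 0) (hcard : m ≤ s.card) :
    flatEntropy q (1 / m) ≤ tsallisEntropy q p := by
  have hm' : (0 : ℝ) < m := by exact_mod_cast hm
  set c : ℝ := 1 / m with hc
  have hc0 : 0 < c := by positivity
  have tangent : ∀ j, p j ≠ 0 → c ^ q * (1 + q * (p j / c - 1)) ≤ p j ^ q := by
    intro j hj
    have hj : 0 < p j := lt_of_le_of_ne (hp0 j) hj.symm
    have h1 : p j ^ q = c ^ q * (p j / c) ^ q := by
      rw [← Real.mul_rpow hc0.le (by positivity)]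
      congr 1; field_simp
    rw [h1]
    refine mul_le_mul_of_nonneg_left ?_ (by positivity)
    rw [Real.rpow_def_of_pos (by positivity)]
    -- With `y = p j / c`: `y ^ q ≥ 1 + q * log y ≥ 1 + q * (y - 1)`, the last step because `q < 0`.
    have h2 := Real.add_one_le_exp (Real.log (p j / c) * q)
    have h3 := Real.log_le_sub_one_of_pos (show 0 < p j / c by positivity)
    nlinarith
  have h1 : ∑ j, (if p j = 0 then 0 else p j ^ q) ≥
      ∑ j, (if p j = 0 then 0 else c ^ q * (1 - q)) + c ^ q * (q / c) := by
    have : c ^ q * (q / c) = ∑ j, c ^ q * (q / c) * p j := by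
      rw [← Finset.mul_sum, hsum, mul_one]
    rw [this, ← Finset.sum_add_distrib]
    refine Finset.sum_le_sum fun j _ => ?_
    split_ifs with hj
    · simp [hj]
    · refine le_trans (le_of_eq ?_) (tangent j hj)
      ring
  have h2 : ∑ j, (if p j = 0 then 0 else c ^ q * (1 - q)) ≥ m * (c ^ q * (1 - q)) := by
    have hpos : 0 ≤ c ^ q * (1 - q) := mul_nonneg (by positivity) (by linarith)
    calc (m : ℝ) * (c ^ q * (1 - q)) ≤ s.card * (c ^ q * (1 - q)) := by gcongr
      _ = ∑ j ∈ s, (if p j = 0 then 0 else c ^ q * (1 - q)) := by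
        rw [Finset.sum_congr rfl fun j hj => if_neg (hs j hj)]; simp
      _ ≤ _ := Finset.sum_le_sum_of_subset_of_nonneg (Finset.subset_univ _) fun j _ _ => by
        split_ifs <;> simp [hpos]
  have h3 : (m : ℝ) * (c ^ q * (1 - q)) + c ^ q * (q / c) = c ^ (q - 1) := by
    rw [Real.rpow_sub_one hc0.ne', show (m : ℝ) = 1 / c by simp [hc]]
    field_simp; ring
  unfold tsallisEntropy flatEntropy
  rw [if_neg (by linarith), if_neg (by linarith)]
  exact mul_le_mul_of_nonpos_left (by linarith) (one_div_nonpos.2 (by linarith))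

/-- For `q ≥ 0` the Tsallis entropy lies below its tangent at any point `p`, on the face of the
positive cone that contains `p` in its relative interior. -/
lemma exists_tsallisEntropy_le_tangent {ι : Type} [Fintype ι] (q : ℝ) (hq : 0 ≤ q) (p : ι → ℝ)
    (hp0 : ∀ j, 0 ≤ p j) :
    ∃ D : ι → ℝ, ∀ s : ι → ℝ, (∀ j, 0 ≤ s j) → (∀ j, p j = 0 → s j = 0) →
      tsallisEntropy q s ≤ tsallisEntropy q p + ∑ j, D j * (s j - p j) := by
  unfold tsallisEntropy
  by_cases h1 : q = 1
  · simp only [h1, if_true]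
    refine ⟨fun j => -Real.log (p j) - 1, fun s hs0 hsp => ?_⟩
    rw [← Finset.sum_neg_distrib, ← Finset.sum_neg_distrib, ← Finset.sum_add_distrib]
    refine Finset.sum_le_sum fun j _ => ?_
    rcases (hs0 j).eq_or_lt with h | h
    · simp only [← h, zero_mul]
      linarith [hp0 j]
    · have hp : 0 < p j := lt_of_le_of_ne (hp0 j) fun h' => h.ne' (hsp j h'.symm)
      have h3 := Real.log_le_sub_one_of_pos (show 0 < p j / s j by positivity)
      rw [Real.log_div hp.ne' h.ne'] at h3
      have h4 := mul_le_mul_of_nonneg_left h3 h.le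
      have h5 : s j * (p j / s j - 1) = p j - s j := by field_simp
      linarith
  simp only [h1, if_false]
  rcases hq.eq_or_lt with rfl | hq
  -- At `q = 0` the entropy is the support size minus one, so it cannot grow on the face of `p` and
  -- a zero slope works.
  · refine ⟨0, fun s hs0 hsp => ?_⟩
    have : ∑ j, (if s j = 0 then 0 else s j ^ (0 : ℝ)) ≤
        ∑ j, (if p j = 0 then 0 else p j ^ (0 : ℝ)) := by
      refine Finset.sum_le_sum fun j _ => ?_
      by_cases hp : p j = 0
      · simp [hp, hsp j hp]
      · by_cases hs : s j = 0 <;> simp [hp, hs]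
    norm_num at this ⊢
    exact this
  have hterm : ∀ x : ℝ, (if x = 0 then 0 else x ^ q) = x ^ q := by
    intro x
    split_ifs with h
    · rw [h, Real.zero_rpow hq.ne']
    · rfl
  simp only [hterm]
  have hscale : ∀ s p : ℝ, 0 ≤ s → 0 < p → s ^ q = p ^ q * (1 + (s / p - 1)) ^ q := by
    intro s p hs hp
    rw [← Real.mul_rpow hp.le (by rw [add_sub_cancel]; positivity)]
    congr 1; field_simp; ring
  have hlin : ∀ s p : ℝ, 0 < p → p ^ q * (1 + q * (s / p - 1)) = p ^ q + q * p ^ (q - 1) * (s - p) := by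
    intro s p hp
    rw [Real.rpow_sub_one hp.ne']
    field_simp
  -- The gradient at `p`; its value where `p j = 0` is irrelevant, since there `s j - p j = 0`. The
  -- tangent inequality is Bernoulli's.
  refine ⟨fun j => -(1 / (q - 1) * (q * p j ^ (q - 1))), fun s hs0 hsp => ?_⟩
  have hD : ∑ j, -(1 / (q - 1) * (q * p j ^ (q - 1))) * (s j - p j)
      = -(1 / (q - 1)) * ∑ j, q * p j ^ (q - 1) * (s j - p j) := by
    rw [Finset.mul_sum]
    exact Finset.sum_congr rfl fun j _ => by ring
  rw [hD]
  rcases lt_or_gt_of_ne h1 with h1 | h1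
  · have : ∑ j, s j ^ q ≤ ∑ j, (p j ^ q + q * p j ^ (q - 1) * (s j - p j)) := by
      refine Finset.sum_le_sum fun j _ => ?_
      rcases (hp0 j).eq_or_lt with h | h
      · simp [hsp j h.symm, ← h, Real.zero_rpow hq.ne']
      · rw [hscale _ _ (hs0 j) h, ← hlin _ _ h]
        refine mul_le_mul_of_nonneg_left (rpow_one_add_le_one_add_mul_self ?_ hq.le h1.le)
          (by positivity)
        have := div_nonneg (hs0 j) h.le
        linarith
    rw [Finset.sum_add_distrib] at this
    have h2 : 1 / (q - 1) ≤ 0 := one_div_nonpos.2 (by linarith)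
    nlinarith
  · have : ∑ j, (p j ^ q + q * p j ^ (q - 1) * (s j - p j)) ≤ ∑ j, s j ^ q := by
      refine Finset.sum_le_sum fun j _ => ?_
      rcases (hp0 j).eq_or_lt with h | h
      · simp [hsp j h.symm, ← h, Real.zero_rpow hq.ne']
      · rw [hscale _ _ (hs0 j) h, ← hlin _ _ h]
        refine mul_le_mul_of_nonneg_left (one_add_mul_self_le_rpow_one_add ?_ h1.le)
          (by positivity)
        have := div_nonneg (hs0 j) h.le
        linarith
    rw [Finset.sum_add_distrib] at this
    have h2 : 0 ≤ 1 / (q - 1) := one_div_nonneg.2 (by linarith)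
    nlinarith

/-! ### Planar convexity -/

/-- If the origin of the plane is a mixture of finitely many points, then some mixture of two of
them has nonpositive coordinates. -/
lemma exists_pair_mixture_nonpos {ι : Type*} [Fintype ι] (w u v : ι → ℝ)
    (hw : ∀ k, 0 < w k) (hw1 : ∑ k, w k = 1) (hu : ∑ k, w k * u k = 0)
    (hv : ∑ k, w k * v k = 0) :
    ∃ (i j : ι) (t : ℝ), 0 ≤ t ∧ t ≤ 1 ∧ (1 - t) * u i + t * u j ≤ 0 ∧
      (1 - t) * v i + t * v j ≤ 0 := by
  by_cases hex : ∃ k, u k ≤ 0 ∧ v k ≤ 0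
  · obtain ⟨k, hk⟩ := hex
    exact ⟨k, k, 0, le_rfl, zero_le_one, by simpa using hk.1, by simpa using hk.2⟩
  push Not at hex
  have hne : (Finset.univ : Finset ι).Nonempty := by
    rw [Finset.nonempty_iff_ne_empty]
    intro h
    simp [h] at hw1
  obtain ⟨k₀, hk₀⟩ : ∃ k, u k < 0 := by
    by_contra! h
    have h0 := (Finset.sum_eq_zero_iff_of_nonneg fun k _ => mul_nonneg (hw k).le (h k)).1 hu
    have hv' : 0 < ∑ k, w k * v k := Finset.sum_pos (fun k _ => mul_pos (hw k) (hex k (by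
      have := h0 k (Finset.mem_univ k)
      simp [(hw k).ne'] at this
      exact this.le))) hne
    exact hv'.ne' hv
  -- The line `v + r * u = 0` through the origin and point `i` has all points with `u < 0` on or
  -- above it.
  obtain ⟨i, hi, himin⟩ := Finset.exists_min_image (Finset.univ.filter fun k => u k < 0)
    (fun k => v k / (-u k)) ⟨k₀, by simpa using hk₀⟩
  simp only [Finset.mem_filter, Finset.mem_univ, true_and] at hi himin
  set r := v i / (-u i) with hr
  have hr0 : 0 < r := div_pos (hex i hi.le) (by linarith)
  have hri : v i = r * (-u i) := by
    rw [hr, div_mul_cancel₀ _ (neg_ne_zero.2 hi.ne)]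
  have hneg : ∀ k, u k < 0 → 0 ≤ v k + r * u k := by
    intro k hk
    have := (le_div_iff₀ (by linarith)).1 (himin k hk)
    linarith
  -- Otherwise every point is weakly above the line; the mean being zero, all lie on it, hence all
  -- have `u < 0`, against `∑ w u = 0`.
  obtain ⟨j, hj0, hj⟩ : ∃ j, 0 < u j ∧ v j + r * u j ≤ 0 := by
    by_contra! h
    have hall : ∀ k, 0 ≤ v k + r * u k := by
      intro k
      rcases lt_trichotomy (u k) 0 with hk | hk | hk
      · exact hneg k hk
      · simpa [hk] using (hex k hk.le).le
      · exact (h k hk).le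
    have hs : ∑ k, w k * (v k + r * u k) = 0 := by
      have : ∑ k, w k * (v k + r * u k) = ∑ k, w k * v k + r * ∑ k, w k * u k := by
        rw [Finset.mul_sum, ← Finset.sum_add_distrib]
        exact Finset.sum_congr rfl fun k _ => by ring
      rw [this, hu, hv]; simp
    have h0 := (Finset.sum_eq_zero_iff_of_nonneg fun k _ => mul_nonneg (hw k).le (hall k)).1 hs
    have hu' : 0 < ∑ k, w k * (-u k) := by
      refine Finset.sum_pos (fun k _ => mul_pos (hw k) ?_) hne
      have h00 := h0 k (Finset.mem_univ k)
      simp only [mul_eq_zero, (hw k).ne', false_or] at h00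
      rcases lt_trichotomy (u k) 0 with hk | hk | hk
      · linarith
      · have := hex k hk.le
        simp [hk] at h00
        linarith
      · linarith [h k hk]
    simp [hu] at hu'
  have hd : 0 < u j - u i := by linarith
  -- The weight at which the segment crosses `u = 0`.
  refine ⟨i, j, -u i / (u j - u i), div_nonneg (by linarith) hd.le,
    (div_le_one hd).2 (by linarith), le_of_eq ?_, ?_⟩
  · field_simp; ring
  · have : (1 - -u i / (u j - u i)) * v i + -u i / (u j - u i) * v j
        = -u i * (v j + r * u j) / (u j - u i) := by
      rw [hri]; field_simp; ring
    rw [this]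
    exact div_nonpos_of_nonpos_of_nonneg (mul_nonpos_of_nonneg_of_nonpos (by linarith) hj) hd.le

/-! ### Mixtures of product distributions on two bits -/

/-- The distribution of two independent signs with expectation values `x` and `y`. -/
noncomputable def signDist (x y : ℝ) (k : Fin 2 × Fin 2) : ℝ :=
  (1 + (-1) ^ (k.1 : ℕ) * x) / 2 * ((1 + (-1) ^ (k.2 : ℕ) * y) / 2)

lemma sum_signDist (x y : ℝ) : ∑ k, signDist x y k = 1 := by
  simp [Fintype.sum_prod_type, signDist]
  ring

lemma abs_le_one_of_circle {x z : ℝ} (h : x ^ 2 + z ^ 2 = 1) : |x| ≤ 1 ∧ |z| ≤ 1 :=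
  ⟨abs_le_one_iff_mul_self_le_one.2 (by nlinarith), abs_le_one_iff_mul_self_le_one.2 (by nlinarith)⟩

lemma neg_one_pow_mul_mem {x : ℝ} (hx : |x| ≤ 1) (i : Fin 2) :
    0 ≤ 1 + (-1) ^ (i : ℕ) * x ∧ 1 + (-1) ^ (i : ℕ) * x ≤ 2 := by
  have := abs_le.1 hx
  fin_cases i <;> simp <;> constructor <;> linarith

lemma signDist_nonneg {x y : ℝ} (hx : |x| ≤ 1) (hy : |y| ≤ 1) (k : Fin 2 × Fin 2) :
    0 ≤ signDist x y k :=
  mul_nonneg (by linarith [neg_one_pow_mul_mem hx k.1]) (by linarith [neg_one_pow_mul_mem hy k.2])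

lemma signDist_le_half {x y : ℝ} (hx : |x| ≤ 1) (hy : |y| ≤ 1) (h : x = 0 ∨ y = 0)
    (k : Fin 2 × Fin 2) : signDist x y k ≤ 1 / 2 := by
  have h1 := neg_one_pow_mul_mem hx k.1
  have h2 := neg_one_pow_mul_mem hy k.2
  unfold signDist
  rcases h with rfl | rfl <;> simp only [mul_zero, add_zero] <;> linarith

/-- An impossible `z` outcome puts the point at a pole of the circle. -/
lemma eq_zero_of_neg_one_pow_mul {x z : ℝ} (h : x ^ 2 + z ^ 2 = 1) (i : Fin 2)
    (hz : 1 + (-1) ^ (i : ℕ) * z = 0) : x = 0 := by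
  have : z ^ 2 = 1 := by
    fin_cases i <;> simp at hz
    · have : z = -1 := by linarith
      simp [this]
    · have : z = 1 := by linarith
      simp [this]
  exact pow_eq_zero_iff two_ne_zero |>.1 (by linarith)

lemma signDist_zero_zero (k : Fin 2 × Fin 2) : signDist 0 0 k = 1 / 4 := by
  norm_num [signDist]

lemma tsallisEntropy_signDist_zero_zero (q : ℝ) :
    tsallisEntropy q (signDist 0 0) = flatEntropy q (1 / 4) :=
  tsallisEntropy_eq_flatEntropy q _ (by norm_num) _ (fun k => Or.inr (signDist_zero_zero k))
    (sum_signDist _ _)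

lemma tsallisEntropy_signDist_one_one (q : ℝ) :
    tsallisEntropy q (signDist 1 1) = flatEntropy q 1 := by
  refine tsallisEntropy_eq_flatEntropy q _ (by norm_num) _ (fun k => ?_) (sum_signDist _ _)
  rcases k with ⟨i, j⟩
  fin_cases i <;> fin_cases j <;> norm_num [signDist]

lemma tsallisEntropy_signDist_zero_one (q : ℝ) :
    tsallisEntropy q (signDist 0 1) = flatEntropy q (1 / 2) := by
  refine tsallisEntropy_eq_flatEntropy q _ (by norm_num) _ (fun k => ?_) (sum_signDist _ _)
  rcases k with ⟨i, j⟩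
  fin_cases i <;> fin_cases j <;> norm_num [signDist]

lemma tsallisEntropy_signDist_one_zero (q : ℝ) :
    tsallisEntropy q (signDist 1 0) = flatEntropy q (1 / 2) := by
  refine tsallisEntropy_eq_flatEntropy q _ (by norm_num) _ (fun k => ?_) (sum_signDist _ _)
  rcases k with ⟨i, j⟩
  fin_cases i <;> fin_cases j <;> norm_num [signDist]

/-- The pairs of sign distributions of two commuting pairs of measurements `x ⊗ x`, `z ⊗ z`
on products of two points `(x, z)` of the unit circle. -/
def circlePairs : Set ((Fin 2 × Fin 2 → ℝ) × (Fin 2 × Fin 2 → ℝ)) :=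
  {P | ∃ x₁ z₁ x₂ z₂ : ℝ, x₁ ^ 2 + z₁ ^ 2 = 1 ∧ x₂ ^ 2 + z₂ ^ 2 = 1 ∧
    P = (signDist x₁ x₂, signDist z₁ z₂)}

/-- Mixtures of at most two elements of `circlePairs`. -/
def twoMixtures : Set ((Fin 2 × Fin 2 → ℝ) × (Fin 2 × Fin 2 → ℝ)) :=
  {P | ∃ A ∈ circlePairs, ∃ B ∈ circlePairs, ∃ t : ℝ, 0 ≤ t ∧ t ≤ 1 ∧ P = (1 - t) • A + t • B}

lemma circlePairs_subset_twoMixtures : circlePairs ⊆ twoMixtures :=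
  fun P hP => ⟨P, hP, P, hP, 0, le_rfl, zero_le_one, by simp⟩

lemma swap_mem_circlePairs {P : (Fin 2 × Fin 2 → ℝ) × (Fin 2 × Fin 2 → ℝ)}
    (hP : P ∈ circlePairs) : P.swap ∈ circlePairs := by
  obtain ⟨x₁, z₁, x₂, z₂, h₁, h₂, rfl⟩ := hP
  exact ⟨z₁, x₁, z₂, x₂, by linarith, by linarith, rfl⟩

lemma swap_mem_twoMixtures {P : (Fin 2 × Fin 2 → ℝ) × (Fin 2 × Fin 2 → ℝ)}
    (hP : P ∈ twoMixtures) : P.swap ∈ twoMixtures := by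
  obtain ⟨A, hA, B, hB, t, h0, h1, rfl⟩ := hP
  exact ⟨_, swap_mem_circlePairs hA, _, swap_mem_circlePairs hB, t, h0, h1, rfl⟩

lemma swap_mem_convexHull_circlePairs {P : (Fin 2 × Fin 2 → ℝ) × (Fin 2 × Fin 2 → ℝ)}
    (hP : P ∈ convexHull ℝ circlePairs) : P.swap ∈ convexHull ℝ circlePairs := by
  have hc : Convex ℝ {P : (Fin 2 × Fin 2 → ℝ) × (Fin 2 × Fin 2 → ℝ) |
      P.swap ∈ convexHull ℝ circlePairs} := by
    intro P hP Q hQ a b ha hb hab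
    exact convex_convexHull ℝ circlePairs hP hQ ha hb hab
  have hs : circlePairs ⊆ {P : (Fin 2 × Fin 2 → ℝ) × (Fin 2 × Fin 2 → ℝ) |
      P.swap ∈ convexHull ℝ circlePairs} :=
    fun Q hQ => subset_convexHull ℝ circlePairs (swap_mem_circlePairs hQ)
  exact convexHull_min hs hc hP

lemma nonneg_of_mem_circlePairs {P : (Fin 2 × Fin 2 → ℝ) × (Fin 2 × Fin 2 → ℝ)}
    (hP : P ∈ circlePairs) (k : Fin 2 × Fin 2) : 0 ≤ P.1 k ∧ 0 ≤ P.2 k := by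
  obtain ⟨x₁, z₁, x₂, z₂, h₁, h₂, rfl⟩ := hP
  have h₁ := abs_le_one_of_circle h₁
  have h₂ := abs_le_one_of_circle h₂
  exact ⟨signDist_nonneg h₁.1 h₂.1 k, signDist_nonneg h₁.2 h₂.2 k⟩

lemma sum_of_mem_circlePairs {P : (Fin 2 × Fin 2 → ℝ) × (Fin 2 × Fin 2 → ℝ)}
    (hP : P ∈ circlePairs) : ∑ k, P.1 k = 1 ∧ ∑ k, P.2 k = 1 := by
  obtain ⟨x₁, z₁, x₂, z₂, h₁, h₂, rfl⟩ := hP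
  exact ⟨sum_signDist _ _, sum_signDist _ _⟩

/-! ### Tangent functionals on finite mixtures -/

section Mixture

variable {ι κ : Type} [Fintype ι] {w : ι → ℝ} {f : ι → κ → ℝ}

lemma sum_mixture_eq_one [Fintype κ] (hw1 : ∑ i, w i = 1) (hf : ∀ i, ∑ k, f i k = 1) :
    ∑ k, ∑ i, w i * f i k = 1 := by
  rw [Finset.sum_comm]
  simp only [← Finset.mul_sum, hf, mul_one, hw1]

lemma eq_zero_of_mixture_eq_zero (hw : ∀ i, 0 < w i) (hf : ∀ i k, 0 ≤ f i k) {k : κ}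
    (h : ∑ i, w i * f i k = 0) (i : ι) : f i k = 0 := by
  have := (Finset.sum_eq_zero_iff_of_nonneg fun i _ => mul_nonneg (hw i).le (hf i k)).1 h i
    (Finset.mem_univ i)
  simpa [(hw i).ne'] using this

/-- `u i` is the tangent functional at the mixture, evaluated at `f i`. Positive weights make each
`f i` vanish wherever the mixture does, so the tangent bound applies on that face. -/
lemma exists_tangent_of_mixture [Fintype κ] (q : ℝ) (hq : 0 ≤ q) (hw : ∀ i, 0 < w i) (hw1 : ∑ i, w i = 1)
    (hf : ∀ i k, 0 ≤ f i k) :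
    ∃ u : ι → ℝ, ∑ i, w i * u i = 0 ∧ ∀ (i j : ι) (t : ℝ), 0 ≤ t → t ≤ 1 →
      (1 - t) * u i + t * u j ≤ 0 →
      tsallisEntropy q ((1 - t) • f i + t • f j) ≤ tsallisEntropy q fun k => ∑ i, w i * f i k := by
  set p : κ → ℝ := fun k => ∑ i, w i * f i k with hp
  obtain ⟨D, hD⟩ := exists_tsallisEntropy_le_tangent q hq p
    fun k => Finset.sum_nonneg fun i _ => mul_nonneg (hw i).le (hf i k)
  refine ⟨fun i => ∑ k, D k * (f i k - p k), ?_, fun i j t h0 h1 ht => ?_⟩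
  · simp only [Finset.mul_sum]
    rw [Finset.sum_comm]
    refine Finset.sum_eq_zero fun k _ => ?_
    have : ∑ i, w i * (D k * (f i k - p k)) = D k * (∑ i, w i * f i k - (∑ i, w i) * p k) := by
      rw [Finset.sum_mul, ← Finset.sum_sub_distrib, Finset.mul_sum]
      exact Finset.sum_congr rfl fun i _ => by ring
    rw [this, hw1]
    simp [hp]
  · refine (hD _ (fun k => ?_) fun k hk => ?_).trans ?_
    · exact add_nonneg (mul_nonneg (by linarith) (hf i k)) (mul_nonneg h0 (hf j k))
    · simp [eq_zero_of_mixture_eq_zero hw hf hk i, eq_zero_of_mixture_eq_zero hw hf hk j]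
    · have : ∑ k, D k * (((1 - t) • f i + t • f j) k - p k) =
          (1 - t) * ∑ k, D k * (f i k - p k) + t * ∑ k, D k * (f j k - p k) := by
        rw [Finset.mul_sum, Finset.mul_sum, ← Finset.sum_add_distrib]
        refine Finset.sum_congr rfl fun k _ => ?_
        simp only [Pi.add_apply, Pi.smul_apply, smul_eq_mul]
        ring
      linarith

end Mixture

lemma exists_positive_mixture_of_mem_convexHull
    {P : (Fin 2 × Fin 2 → ℝ) × (Fin 2 × Fin 2 → ℝ)} (hP : P ∈ convexHull ℝ circlePairs) :
    ∃ (ι : Type) (_ : Fintype ι) (w : ι → ℝ) (z : ι → (Fin 2 × Fin 2 → ℝ) × (Fin 2 × Fin 2 → ℝ)),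
      (∀ i, 0 < w i) ∧ ∑ i, w i = 1 ∧ (∀ i, z i ∈ circlePairs) ∧
      P.1 = (fun k => ∑ i, w i * (z i).1 k) ∧ P.2 = fun k => ∑ i, w i * (z i).2 k := by
  obtain ⟨ι, hι, z, w, hz, -, hw, hw1, h⟩ := eq_pos_convex_span_of_mem_convexHull hP
  refine ⟨ι, hι, w, z, hw, hw1, fun i => hz ⟨i, rfl⟩, ?_, ?_⟩
  · rw [← h]; ext k; simp [Prod.fst_sum]
  · rw [← h]; ext k; simp [Prod.snd_sum]

/-- Domination by a two-term mixture when the entropies are concave. -/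
lemma exists_twoMixtures_le_of_nonneg (q q' : ℝ) (hq : 0 ≤ q) (hq' : 0 ≤ q')
    {P : (Fin 2 × Fin 2 → ℝ) × (Fin 2 × Fin 2 → ℝ)} (hP : P ∈ convexHull ℝ circlePairs) :
    ∃ Q ∈ twoMixtures, tsallisEntropy q' Q.1 ≤ tsallisEntropy q' P.1 ∧
      tsallisEntropy q Q.2 ≤ tsallisEntropy q P.2 := by
  obtain ⟨ι, _, w, z, hw, hw1, hz, h1, h2⟩ := exists_positive_mixture_of_mem_convexHull hP
  obtain ⟨u, hu, hu'⟩ := exists_tangent_of_mixture (f := fun i => (z i).1) q' hq' hw hw1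
    fun i k => (nonneg_of_mem_circlePairs (hz i) k).1
  obtain ⟨v, hv, hv'⟩ := exists_tangent_of_mixture (f := fun i => (z i).2) q hq hw hw1
    fun i k => (nonneg_of_mem_circlePairs (hz i) k).2
  obtain ⟨i, j, t, ht0, ht1, hut, hvt⟩ := exists_pair_mixture_nonpos w u v hw hw1 hu hv
  refine ⟨_, ⟨z i, hz i, z j, hz j, t, ht0, ht1, rfl⟩, ?_, ?_⟩
  · rw [h1]; exact hu' i j t ht0 ht1 hut
  · rw [h2]; exact hv' i j t ht0 ht1 hvt

/-- For negative order the entropy is not concave, but then one of three product states of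
Pauli eigenvectors dominates, depending on how many outcomes have nonzero probability. -/
lemma exists_twoMixtures_le_of_neg (q q' : ℝ) (hq : q < 0)
    {P : (Fin 2 × Fin 2 → ℝ) × (Fin 2 × Fin 2 → ℝ)} (hP : P ∈ convexHull ℝ circlePairs) :
    ∃ Q ∈ twoMixtures, tsallisEntropy q' Q.1 ≤ tsallisEntropy q' P.1 ∧
      tsallisEntropy q Q.2 ≤ tsallisEntropy q P.2 := by
  obtain ⟨ι, _, w, z, hw, hw1, hz, h1, h2⟩ := exists_positive_mixture_of_mem_convexHull hP
  have hz1 : ∀ i k, 0 ≤ (z i).1 k := fun i k => (nonneg_of_mem_circlePairs (hz i) k).1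
  have hz2 : ∀ i k, 0 ≤ (z i).2 k := fun i k => (nonneg_of_mem_circlePairs (hz i) k).2
  have hP1 : ∀ k, 0 ≤ P.1 k := fun k => by
    rw [h1]; exact Finset.sum_nonneg fun i _ => mul_nonneg (hw i).le (hz1 i k)
  have hP2 : ∀ k, 0 ≤ P.2 k := fun k => by
    rw [h2]; exact Finset.sum_nonneg fun i _ => mul_nonneg (hw i).le (hz2 i k)
  have hs1 : ∑ k, P.1 k = 1 := by
    rw [h1]; exact sum_mixture_eq_one hw1 fun i => (sum_of_mem_circlePairs (hz i)).1
  have hs2 : ∑ k, P.2 k = 1 := by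
    rw [h2]; exact sum_mixture_eq_one hw1 fun i => (sum_of_mem_circlePairs (hz i)).2
  have hone : ∀ p : Fin 2 × Fin 2 → ℝ, (∀ k, 0 ≤ p k) → ∑ k, p k = 1 → ∀ k, p k ≤ 1 :=
    fun p hp hs k => hs ▸ Finset.single_le_sum (fun k _ => hp k) (Finset.mem_univ k)
  have hvanish : ∀ k, P.2 k = 0 → ∀ i, (z i).2 k = 0 := fun k hk i =>
    eq_zero_of_mixture_eq_zero (f := fun i => (z i).2) hw hz2 (by rw [h2] at hk; exact hk) i
  -- Full support: two `σ_x` eigenvectors give zero entropy for `x` and the bound for four outcomes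
  -- for `z`.
  by_cases hfull : ∀ k, P.2 k ≠ 0
  · refine ⟨(signDist 1 1, signDist 0 0), circlePairs_subset_twoMixtures
      ⟨1, 0, 1, 0, by norm_num, by norm_num, rfl⟩, ?_, ?_⟩
    · rw [tsallisEntropy_signDist_one_one]
      exact flatEntropy_le_tsallisEntropy_of_le q' 1 _ hP1 (hone _ hP1 hs1) hs1
    · rw [tsallisEntropy_signDist_zero_zero]
      exact flatEntropy_le_tsallisEntropy_of_card_le q hq 4 (by norm_num) _ hP2 hs2
        Finset.univ (fun k _ => hfull k) (by simp)
  push Not at hfull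
  obtain ⟨k₀, hk₀⟩ := hfull
  obtain ⟨a, ha⟩ : ∃ a, P.2 a ≠ 0 := by
    by_contra! h
    simp [h] at hs2
  -- Two or three outcomes: the missing one gives every component a factor with `x = 0`, so all `x ⊗
  -- x` probabilities are at most `1 / 2`. One `σ_z` and one `σ_x` eigenvector attain both bounds.
  by_cases htwo : ∃ b, b ≠ a ∧ P.2 b ≠ 0
  · obtain ⟨b, hba, hb⟩ := htwo
    refine ⟨(signDist 0 1, signDist 1 0), circlePairs_subset_twoMixtures
      ⟨0, 1, 1, 0, by norm_num, by norm_num, rfl⟩, ?_, ?_⟩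
    · rw [tsallisEntropy_signDist_zero_one]
      refine flatEntropy_le_tsallisEntropy_of_le q' _ _ hP1 (fun k => ?_) hs1
      have hle : ∀ i, (z i).1 k ≤ 1 / 2 := by
        intro i
        have hzero := hvanish k₀ hk₀ i
        obtain ⟨x₁, z₁, x₂, z₂, e₁, e₂, e⟩ := hz i
        rw [e] at hzero ⊢
        refine signDist_le_half (abs_le_one_of_circle e₁).1 (abs_le_one_of_circle e₂).1 ?_ k
        rcases mul_eq_zero.1 hzero with h | h
        · exact Or.inl (eq_zero_of_neg_one_pow_mul e₁ k₀.1 (by linarith))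
        · exact Or.inr (eq_zero_of_neg_one_pow_mul e₂ k₀.2 (by linarith))
      rw [h1]
      calc ∑ i, w i * (z i).1 k ≤ ∑ i, w i * (1 / 2) :=
            Finset.sum_le_sum fun i _ => mul_le_mul_of_nonneg_left (hle i) (hw i).le
        _ = 1 / 2 := by rw [← Finset.sum_mul, hw1, one_mul]
    · rw [tsallisEntropy_signDist_one_zero]
      have := flatEntropy_le_tsallisEntropy_of_card_le q hq 2 (by norm_num) _ hP2 hs2
        {b, a} (by simp [ha, hb]) (by rw [Finset.card_pair hba])
      exact_mod_cast this
  -- One outcome: every component has both factors at poles, so its `x ⊗ x` distribution is already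
  -- uniform.
  · push Not at htwo
    refine ⟨(signDist 0 0, signDist 1 1), circlePairs_subset_twoMixtures
      ⟨0, 1, 0, 1, by norm_num, by norm_num, rfl⟩, le_of_eq ?_, ?_⟩
    · congr 1
      have hx : ∀ i, (z i).1 = signDist 0 0 := by
        intro i
        have hzero : ∀ b, b ≠ a → (z i).2 b = 0 := fun b hb => hvanish b (htwo b hb) i
        obtain ⟨x₁, z₁, x₂, z₂, e₁, e₂, e⟩ := hz i
        rw [e] at hzero ⊢
        obtain ⟨a₁, a₂⟩ := a
        have hflip : ∀ j : Fin 2, j + 1 ≠ j ∧ (-1 : ℝ) ^ ((j + 1 : Fin 2) : ℕ) = -(-1) ^ (j : ℕ) := by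
          intro j; fin_cases j <;> simp
        -- `z11 + z10` and `z11 + z01` are the marginal probabilities of the flipped outcome on each
        -- qubit.
        have z11 := hzero (a₁ + 1, a₂ + 1) (by simp)
        have z10 := hzero (a₁ + 1, a₂) (by simp)
        have z01 := hzero (a₁, a₂ + 1) (by simp)
        simp only [signDist, (hflip _).2] at z11 z10 z01
        have hx₁ : x₁ = 0 := eq_zero_of_neg_one_pow_mul e₁ (a₁ + 1) (by
          rw [(hflip _).2]; linarith)
        have hx₂ : x₂ = 0 := eq_zero_of_neg_one_pow_mul e₂ (a₂ + 1) (by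
          rw [(hflip _).2]; linarith)
        rw [hx₁, hx₂]
      rw [h1]
      funext k
      simp only [hx, ← Finset.sum_mul, hw1, one_mul]
    · rw [tsallisEntropy_signDist_one_one]
      exact flatEntropy_le_tsallisEntropy_of_le q 1 _ hP2 (hone _ hP2 hs2) hs2

lemma exists_twoMixtures_le (q q' : ℝ)
    {P : (Fin 2 × Fin 2 → ℝ) × (Fin 2 × Fin 2 → ℝ)} (hP : P ∈ convexHull ℝ circlePairs) :
    ∃ Q ∈ twoMixtures, tsallisEntropy q' Q.1 ≤ tsallisEntropy q' P.1 ∧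
      tsallisEntropy q Q.2 ≤ tsallisEntropy q P.2 := by
  rcases lt_or_ge q 0 with hq | hq
  · exact exists_twoMixtures_le_of_neg q q' hq hP
  rcases lt_or_ge q' 0 with hq' | hq'
  · obtain ⟨Q, hQ, h1, h2⟩ := exists_twoMixtures_le_of_neg q' q hq'
      (swap_mem_convexHull_circlePairs hP)
    exact ⟨Q.swap, swap_mem_twoMixtures hQ, h2, h1⟩
  · exact exists_twoMixtures_le_of_nonneg q q' hq hq' hP

/-! ### Outcome probabilities of two-qubit states -/

/-- The trace of a one-qubit operator against the outcome projectors of `σ_x` and `σ_z` is given by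
the Bloch coordinates `x` and `z`. -/
def HasBloch (α : QubitOp) (x z : ℝ) : Prop :=
  ∀ i, (α * outcomeProj pauliX i).trace = (((1 + (-1) ^ (i : ℕ) * x) / 2 : ℝ) : ℂ) ∧
    (α * outcomeProj pauliZ i).trace = (((1 + (-1) ^ (i : ℕ) * z) / 2 : ℝ) : ℂ)

lemma hasBloch_of_entries {α : QubitOp} {x z : ℝ} (htr : α 0 0 + α 1 1 = 1)
    (hx : α 0 1 + α 1 0 = x) (hz : α 0 0 - α 1 1 = z) : HasBloch α x z := by
  intro i
  have e : ∀ σ : QubitOp, (α * outcomeProj σ i).trace =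
      (α.trace + (-1) ^ (i : ℕ) * (α * σ).trace) / 2 := by
    intro σ
    simp only [outcomeProj, Matrix.mul_smul, Matrix.mul_add, Matrix.mul_one, Matrix.trace_smul,
      Matrix.trace_add, smul_eq_mul]
    ring
  have ht : α.trace = 1 := by rw [Matrix.trace_fin_two, htr]
  have hX : (α * pauliX).trace = x := by
    rw [← hx]; simp [pauliX, Matrix.trace_fin_two, Matrix.mul_apply, Fin.sum_univ_two]
  have hZ : (α * pauliZ).trace = z := by
    rw [← hz]; simp [pauliZ, Matrix.trace_fin_two, Matrix.mul_apply, Fin.sum_univ_two]; ring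
  rw [e, e, ht, hX, hZ]
  push_cast
  exact ⟨rfl, rfl⟩

lemma IsDensityMatrix.exists_hasBloch {α : QubitOp} (h : IsDensityMatrix α) :
    ∃ x z : ℝ, x ^ 2 + z ^ 2 ≤ 1 ∧ HasBloch α x z := by
  obtain ⟨hpos, htr⟩ := h
  rw [Matrix.trace_fin_two] at htr
  have hherm := hpos.isHermitian
  have h10 : α 1 0 = star (α 0 1) := (hherm.apply 1 0).symm
  have h00 : (α 0 0).im = 0 := Complex.conj_eq_iff_im.1 (hherm.apply 0 0)
  have h11 : (α 1 1).im = 0 := Complex.conj_eq_iff_im.1 (hherm.apply 1 1)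
  have hdet := (Complex.le_def.1 hpos.det_nonneg).1
  rw [Matrix.det_fin_two, h10] at hdet
  simp [h00, h11] at hdet
  have htr' : (α 0 0).re + (α 1 1).re = 1 := by simpa using congrArg Complex.re htr
  refine ⟨2 * (α 0 1).re, (α 0 0).re - (α 1 1).re, ?_, hasBloch_of_entries htr ?_ ?_⟩
  -- At trace one, `4 det α = 1 - x ^ 2 - y ^ 2 - z ^ 2` with `y ^ 2 = 4 (α 0 1).im ^ 2`.
  · nlinarith [sq_nonneg (α 0 1).im]
  · rw [h10]; apply Complex.ext <;> simp; ring
  · apply Complex.ext <;> simp [h00, h11]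

lemma exists_realKet_hasBloch {x z : ℝ} (h : x ^ 2 + z ^ 2 = 1) :
    ∃ a : Fin 2 → ℂ, IsQubitKet a ∧ IsRealKet a ∧ HasBloch (ketBra a) x z := by
  -- Half-angle formulas; `s` carries the sign of `x`.
  obtain ⟨r, s, hrs, hz, hx⟩ : ∃ r s : ℝ, r ^ 2 + s ^ 2 = 1 ∧ r ^ 2 - s ^ 2 = z ∧
      2 * (r * s) = x := by
    have hzz := abs_le.1 (abs_le_one_of_circle h).2
    have hp : Real.sqrt ((1 + z) / 2) ^ 2 = (1 + z) / 2 := Real.sq_sqrt (by linarith)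
    have hm : Real.sqrt ((1 - z) / 2) ^ 2 = (1 - z) / 2 := Real.sq_sqrt (by linarith)
    have hprod : Real.sqrt ((1 + z) / 2) * Real.sqrt ((1 - z) / 2) = |x| / 2 := by
      rw [← Real.sqrt_mul (by linarith), ← Real.sqrt_sq (by positivity : 0 ≤ |x| / 2)]
      congr 1
      rw [div_pow, sq_abs]
      linarith
    rcases abs_cases x with ⟨hx, -⟩ | ⟨hx, -⟩
    · exact ⟨Real.sqrt ((1 + z) / 2), Real.sqrt ((1 - z) / 2), by rw [hp, hm]; ring,
        by rw [hp, hm]; ring, by rw [hprod, hx]; ring⟩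
    · exact ⟨Real.sqrt ((1 + z) / 2), -Real.sqrt ((1 - z) / 2), by rw [neg_sq, hp, hm]; ring,
        by rw [neg_sq, hp, hm]; ring, by rw [mul_neg, hprod, hx]; ring⟩
  refine ⟨![r, s], ?_, ?_, hasBloch_of_entries ?_ ?_ ?_⟩
  · simp [IsQubitKet, hrs]
  · intro i; fin_cases i <;> simp
  · simp [ketBra, vecMulVec_apply]
    exact_mod_cast (by linarith : r * r + s * s = 1)
  · simp [ketBra, vecMulVec_apply]
    exact_mod_cast (by linarith : r * s + s * r = x)
  · simp [ketBra, vecMulVec_apply]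
    exact_mod_cast (by linarith : r * r - s * s = z)

lemma outcomeProb_kronecker {α β : QubitOp} {x₁ z₁ x₂ z₂ : ℝ} (hα : HasBloch α x₁ z₁)
    (hβ : HasBloch β x₂ z₂) :
    outcomeProb pauliX (α ⊗ₖ β) = signDist x₁ x₂ ∧
      outcomeProb pauliZ (α ⊗ₖ β) = signDist z₁ z₂ := by
  constructor <;> funext k <;>
    simp only [outcomeProb, ← Matrix.mul_kronecker_mul, Matrix.trace_kronecker, (hα k.1).1,
      (hβ k.2).1, (hα k.1).2, (hβ k.2).2, ← Complex.ofReal_mul, Complex.ofReal_re, signDist]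

/-- The outcome probabilities as a linear function of the state. -/
noncomputable def outcomeProbLinear (σ : QubitOp) : TwoQubitOp →ₗ[ℝ] (Fin 2 × Fin 2 → ℝ) where
  toFun := outcomeProb σ
  map_add' ρ τ := by funext k; simp [outcomeProb, Matrix.add_mul]
  map_smul' r ρ := by funext k; simp [outcomeProb]

/-- `signDist` is affine in each argument. A disc point lies on the chord between `(s, z)` and `(-s,
z)`; keeping `z` fixed lets one weight serve both distributions. The factors are split one at a
time. -/
lemma signDist_mem_convexHull {x₁ z₁ x₂ z₂ : ℝ} (h₁ : x₁ ^ 2 + z₁ ^ 2 ≤ 1)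
    (h₂ : x₂ ^ 2 + z₂ ^ 2 ≤ 1) :
    (signDist x₁ x₂, signDist z₁ z₂) ∈ convexHull ℝ circlePairs := by
  have split : ∀ x z : ℝ, x ^ 2 + z ^ 2 ≤ 1 → ∃ s t : ℝ, s ^ 2 + z ^ 2 = 1 ∧ 0 ≤ t ∧ t ≤ 1 ∧
      x = (1 - t) * s + t * (-s) := by
    intro x z h
    have hs : Real.sqrt (1 - z ^ 2) ^ 2 = 1 - z ^ 2 := Real.sq_sqrt (by nlinarith)
    have hs0 := Real.sqrt_nonneg (1 - z ^ 2)
    set s := Real.sqrt (1 - z ^ 2)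
    have hx : |x| ≤ s := abs_le_of_sq_le_sq (by linarith) hs0
    rcases hs0.eq_or_lt with h0 | h0
    · refine ⟨s, 0, by linarith, le_rfl, zero_le_one, ?_⟩
      rw [← h0] at hx ⊢
      simpa using hx
    · have hx := abs_le.1 hx
      refine ⟨s, (s - x) / (2 * s), by linarith, div_nonneg (by linarith) (by linarith),
        (div_le_one (by linarith)).2 (by linarith), ?_⟩
      field_simp; ring
  have half : ∀ x₁ z₁ x₂ z₂ : ℝ, x₁ ^ 2 + z₁ ^ 2 = 1 → x₂ ^ 2 + z₂ ^ 2 ≤ 1 →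
      (signDist x₁ x₂, signDist z₁ z₂) ∈ convexHull ℝ circlePairs := by
    intro x₁ z₁ x₂ z₂ h₁ h₂
    obtain ⟨s, t, hs, h0, h1, rfl⟩ := split x₂ z₂ h₂
    have := convex_convexHull ℝ circlePairs
      (subset_convexHull ℝ _ ⟨x₁, z₁, s, z₂, h₁, hs, rfl⟩)
      (subset_convexHull ℝ _ ⟨x₁, z₁, -s, z₂, h₁, by linarith [neg_sq s], rfl⟩)
      (sub_nonneg.2 h1) h0 (by ring)
    convert this using 1
    ext k <;> simp [signDist] <;> ring
  obtain ⟨s, t, hs, h0, h1, rfl⟩ := split x₁ z₁ h₁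
  have := convex_convexHull ℝ circlePairs (half s z₁ x₂ z₂ hs h₂)
    (half (-s) z₁ x₂ z₂ (by linarith [neg_sq s]) h₂) (sub_nonneg.2 h1) h0 (by ring)
  convert this using 1
  ext k <;> simp [signDist] <;> ring

lemma outcomeProb_mem_convexHull {ρ : TwoQubitOp} (hρ : IsSeparableState ρ) :
    (outcomeProb pauliX ρ, outcomeProb pauliZ ρ) ∈ convexHull ℝ circlePairs := by
  let Φ := (outcomeProbLinear pauliX).prod (outcomeProbLinear pauliZ)
  have hmem := Set.mem_image_of_mem Φ hρ
  rw [Φ.image_convexHull] at hmem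
  refine convexHull_min ?_ (convex_convexHull ℝ _) hmem
  rintro _ ⟨_, ⟨α, β, hα, hβ, rfl⟩, rfl⟩
  obtain ⟨x₁, z₁, h₁, hα'⟩ := hα.exists_hasBloch
  obtain ⟨x₂, z₂, h₂, hβ'⟩ := hβ.exists_hasBloch
  have h := outcomeProb_kronecker hα' hβ'
  have := signDist_mem_convexHull h₁ h₂
  rw [← h.1, ← h.2] at this
  exact this

/-! ### Real product states realising circle pairs -/

lemma ketBra_productKet (a b : Fin 2 → ℂ) : ketBra (productKet a b) = ketBra a ⊗ₖ ketBra b := by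
  ext i j
  simp [ketBra, productKet, vecMulVec_apply]
  ring

lemma IsQubitKet.isDensityMatrix {a : Fin 2 → ℂ} (ha : IsQubitKet a) :
    IsDensityMatrix (ketBra a) := by
  refine ⟨Matrix.posSemidef_vecMulVec_self_star a, ?_⟩
  rw [IsQubitKet, Fin.sum_univ_two] at ha
  simp only [ketBra, Matrix.trace_fin_two, vecMulVec_apply, Pi.star_apply, RCLike.star_def,
    Complex.mul_conj, Complex.normSq_eq_norm_sq]
  exact_mod_cast ha

lemma matrix_rank_add_le {m n R : Type*} [Finite m] [Fintype n] [Field R] (A B : Matrix m n R) :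
    (A + B).rank ≤ A.rank + B.rank := by
  unfold Matrix.rank
  rw [Matrix.mulVecLin_add]
  refine (Submodule.finrank_mono ?_).trans (Submodule.finrank_add_le_finrank_add_finrank _ _)
  rintro _ ⟨x, rfl⟩
  exact Submodule.add_mem_sup ⟨x, rfl⟩ ⟨x, rfl⟩

lemma rank_smul_ketBra_le {ι : Type} [Fintype ι] (r : ℝ) (ψ : ι → ℂ) :
    (r • ketBra ψ).rank ≤ 1 := by
  rw [ketBra, ← Matrix.smul_vecMulVec]
  exact Matrix.rank_vecMulVec_le _ _

lemma ketBra_productKet_im {a b : Fin 2 → ℂ} (ha : IsRealKet a) (hb : IsRealKet b)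
    (i j : Fin 2 × Fin 2) : (ketBra (productKet a b) i j).im = 0 := by
  simp [ketBra, productKet, vecMulVec_apply, ha _, hb _]

lemma exists_productKet_of_mem_circlePairs {P : (Fin 2 × Fin 2 → ℝ) × (Fin 2 × Fin 2 → ℝ)}
    (hP : P ∈ circlePairs) :
    ∃ a b : Fin 2 → ℂ, (IsQubitKet a ∧ IsRealKet a) ∧ (IsQubitKet b ∧ IsRealKet b) ∧
      outcomeProbLinear pauliX (ketBra (productKet a b)) = P.1 ∧
      outcomeProbLinear pauliZ (ketBra (productKet a b)) = P.2 := by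
  obtain ⟨x₁, z₁, x₂, z₂, h₁, h₂, rfl⟩ := hP
  obtain ⟨a, ha, ha', hab⟩ := exists_realKet_hasBloch h₁
  obtain ⟨b, hb, hb', hbb⟩ := exists_realKet_hasBloch h₂
  have := outcomeProb_kronecker hab hbb
  rw [← ketBra_productKet] at this
  exact ⟨a, b, ⟨ha, ha'⟩, ⟨hb, hb'⟩, this⟩

theorem mainTheorem5 (q q' : ℝ) (ρ : TwoQubitOp) (hρ : IsSeparableState ρ) :
    ∃ ρ' : TwoQubitOp,
      (∃ (p : ℝ) (a b c d : Fin 2 → ℂ), 0 ≤ p ∧ p ≤ 1 ∧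
        (IsQubitKet a ∧ IsRealKet a) ∧ (IsQubitKet b ∧ IsRealKet b) ∧
        (IsQubitKet c ∧ IsRealKet c) ∧ (IsQubitKet d ∧ IsRealKet d) ∧
        ρ' = (1 - p) • ketBra (productKet a b) + p • ketBra (productKet c d)) ∧
      IsSeparableState ρ' ∧ ρ'.rank ≤ 2 ∧ (∀ i j, (ρ' i j).im = 0) ∧
      entropyXX q' ρ' ≤ entropyXX q' ρ ∧ entropyZZ q ρ' ≤ entropyZZ q ρ := by
  obtain ⟨_, ⟨A, hA, B, hB, p, hp0, hp1, rfl⟩, hX, hZ⟩ :=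
    exists_twoMixtures_le q q' (outcomeProb_mem_convexHull hρ)
  obtain ⟨a, b, ha, hb, hAX, hAZ⟩ := exists_productKet_of_mem_circlePairs hA
  obtain ⟨c, d, hc, hd, hBX, hBZ⟩ := exists_productKet_of_mem_circlePairs hB
  have hlin : ∀ σ, outcomeProb σ
      ((1 - p) • ketBra (productKet a b) + p • ketBra (productKet c d)) =
      (1 - p) • outcomeProbLinear σ (ketBra (productKet a b)) +
        p • outcomeProbLinear σ (ketBra (productKet c d)) := by
    intro σ
    rw [← map_smul, ← map_smul, ← map_add]
    rfl
  refine ⟨_, ⟨p, a, b, c, d, hp0, hp1, ha, hb, hc, hd, rfl⟩, ?_, ?_, fun i j => ?_, ?_, ?_⟩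
  · refine convex_convexHull ℝ _ (subset_convexHull ℝ _ ?_) (subset_convexHull ℝ _ ?_)
      (sub_nonneg.2 hp1) hp0 (by ring)
    · exact ⟨_, _, ha.1.isDensityMatrix, hb.1.isDensityMatrix, ketBra_productKet a b⟩
    · exact ⟨_, _, hc.1.isDensityMatrix, hd.1.isDensityMatrix, ketBra_productKet c d⟩
  · exact (matrix_rank_add_le _ _).trans
      (add_le_add (rank_smul_ketBra_le _ _) (rank_smul_ketBra_le _ _))
  · simp [ketBra_productKet_im ha.2 hb.2, ketBra_productKet_im hc.2 hd.2]
  · rw [entropyXX, entropyXX, hlin, hAX, hBX]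
    exact hX
  · rw [entropyZZ, entropyZZ, hlin, hAZ, hBZ]
    exact hZ
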